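/- \textbf{Setting.} There are $N$ agents and $M$ divisible resources. A profile is $y=(v,x,b)$ with values $v\in\mathcal V\subseteq[\underline v,\overline v]^{NM}$, demands $x\in\mathcal D\subseteq[\underline d,\overline d]^{NM}$ and budgets $b\in\mathcal B\subseteq[0,\overline b]^M$, where $\underline v,\underline d>0$. Agents have fixed weights $w_i\in[0,\overline w]$. The feasible allocations are $\mathcal A_{b,x}=\{a\in\mathbb R^{NM}:0\le a_{i,m}\le x_{i,m},\ \sum_i a_{i,m}\le b_m\}$, and $u_i(a,v,x)=\sum_m v_{i,m}\min\{a_{i,m},x_{i,m}\}$. For a mechanism $f$, mapping each profile $(v,x,b)$ to an element of $\mathcal A_{b,x}$, put $$\mathbf{logNSW}(f,v,x,b)=\log\prod_i u_i(f(v,x,b),v,x)^{w_i},$$ $$\mathbf{expl}_i(f,v,x,b)=\sup_{v_i',x_i'}u_i\big(f((v_i',v_{-i}),(x_i',x_{-i}),b),v,x\big)-u_i\big(f(v,x,b),v,x\big),$$ the supremum being over all $v_i',x_i'$ with $(v_i',v_{-i})\in\mathcal V$ and $(x_i',x_{-i})\in\mathcal D$. \textbf{RPF-Net.} Let $z_\omega:\mathbb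 R^{2NM+M}\to\mathbb R^{NM}$ be the fully connected feed-forward network with $R\ge1$ hidden layers of $K\ge1$ ReLU nodes each and an affine output layer, $\omega\in\mathbb R^d$ being the vector of all its weights and biases. The mechanism is $f_\omega(y)=\phi(y,z_\omega(y))$, where the activation $\phi(y,z)$ is a selected solution of $$\min_{a\in\mathcal A_{b,x}}\ -\sum_i w_i\log(a_i^\top v_i)+\langle a,z\rangle .$$ \textbf{Assumptions.} Let $F$ be a probability distribution on $\mathcal V\times\mathcal D\times\mathcal B$, let $\Omega>0$, $\psi>1$ and $\Phi\ge1$. For $F$-almost every $y$, every agent $i$ and every $\omega$ with $\|\omega\|_1\le\Omega$ we have $1/\psi\le u_i(f_\omega(y),v,x)\le\psi$, and $\sum_{m\in S}v_{i,m}\le1$ for every set $S$ of resources. For each $y\in\mathcal V\times\mathcal D\times\mathcal B$ the activation $\phi(y,\cdot)$ is $\Phi$-Lipschitz in the $\ell^1$ norm on $\{z_\omega(y):\|\omega\|_1\le\Omega\}$. For $\|\omega\|_1\le\Omega$ the functions $\mathbf{logNSW}(f_\omega,\cdot)$ and $\mathbf{expl}_i(f_\omega,\cdot)$ are $F$-measurable.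 Finally $LN\Omega\Phi\max\{K,MN\}\ge2$. \textbf{Theorem (generalization bound).} For a sample $y^1,\dots,y^L$, $L\ge1$, let $$\varepsilon_{\mathbf{logNSW}}(f,L)=-\mathbb E_{y\sim F}[\mathbf{logNSW}(f,y)]+\frac1L\sum_{l=1}^L\mathbf{logNSW}(f,y^l),\qquad \varepsilon_{\mathbf{exp},i}(f,L)=\mathbb E_{y\sim F}[\mathbf{expl}_i(f,y)]-\frac1L\sum_{l=1}^L\mathbf{expl}_i(f,y^l).$$ There is a constant $C>0$, depending only on $\overline v,\overline d,\overline b,\overline w$, such that for every $\delta\in(0,1)$, with probability at least $1-\delta$ over the draw of $L$ i.i.d. profiles from $F$, for all $\omega$ with $\|\omega\|_1\le\Omega$ and all agents $i$, $$\max\{\varepsilon_{\mathbf{logNSW}}(f_\omega,L),\varepsilon_{\mathbf{exp},i}(f_\omega,L)\}\le C\left(\psi N\sqrt{\frac{Rd\log\big(LN\Omega\Phi\max\{K,MN\}\big)}{L}}+(1+\log\psi)\,N\sqrt{\frac{\log(1/\delta)}{L}}\right).$$ -/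

import Mathlib

open MeasureTheory

namespace RPFNet

noncomputable section

/-- Arrays indexed by `N` agents and `M` resources (allocations, values, demands). -/
abbrev Alloc (N M : ℕ) : Type := Fin N → Fin M → ℝ

/-- A profile `y = (v, x, b)`: values, demands, budgets. -/
abbrev Profile (N M : ℕ) : Type := Alloc N M × Alloc N M × (Fin M → ℝ)

/-- Valid allocations: nonnegative, below the demands, within the budgets. -/
def feasibleSet {N M : ℕ} (y : Profile N M) : Set (Alloc N M) :=
  {a | (∀ i m, 0 ≤ a i m ∧ a i m ≤ y.2.1 i m) ∧ ∀ m, ∑ i, a i m ≤ y.2.2 m}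

/-- Thresholded linear additive utility of agent `i`. -/
def utility {N M : ℕ} (a v x : Alloc N M) (i : Fin N) : ℝ :=
  ∑ m, v i m * min (a i m) (x i m)

/-- Nash social welfare of the mechanism `f` with agent weights `w`. -/
def NSW {N M : ℕ} (w : Fin N → ℝ) (f : Profile N M → Alloc N M) (y : Profile N M) : ℝ :=
  ∏ i, utility (f y) y.1 y.2.1 i ^ w i

def logNSW {N M : ℕ} (w : Fin N → ℝ) (f : Profile N M → Alloc N M) (y : Profile N M) : ℝ :=
  Real.log (NSW w f y)

/-- The profile in which agent `i` reports `(v', x')` and everybody else reports as in `y`. -/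
def misreport {N M : ℕ} (y : Profile N M) (i : Fin N) (v' x' : Fin M → ℝ) : Profile N M :=
  (Function.update y.1 i v', Function.update y.2.1 i x', y.2.2)

/-- Exploitability at agent `i`: the largest (supremal) gain in true utility over all
misreports that keep the reported values in `V` and the reported demands in `D`. -/
def expl {N M : ℕ} (V D : Set (Alloc N M)) (f : Profile N M → Alloc N M) (i : Fin N)
    (y : Profile N M) : ℝ :=
  sSup {t | ∃ v' x' : Fin M → ℝ, Function.update y.1 i v' ∈ V ∧ Function.update y.2.1 i x' ∈ D ∧
    t = utility (f (misreport y i v' x')) y.1 y.2.1 i} - utility (f y) y.1 y.2.1 i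

/-! ### The feed-forward ReLU network -/

/-- Coordinates of the network input `(v, x, b)`. -/
abbrev InputIdx (N M : ℕ) : Type := (Fin N × Fin M) ⊕ (Fin N × Fin M) ⊕ Fin M

def netInput {N M : ℕ} (y : Profile N M) : InputIdx N M → ℝ
  | Sum.inl p => y.1 p.1 p.2
  | Sum.inr (Sum.inl p) => y.2.1 p.1 p.2
  | Sum.inr (Sum.inr m) => y.2.2 m

/-- Coordinates of the parameter vector of a network with `R ≥ 1` hidden layers of `K` nodes:
first hidden layer, the `R - 1` further hidden layers, output layer. In every layer the index
`none` is the bias of a node and `some j` is its weight on the `j`-th incoming coordinate. -/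
abbrev ParamIdx (N M R K : ℕ) : Type :=
  (Fin K × Option (InputIdx N M)) ⊕ (Fin (R - 1) × Fin K × Option (Fin K)) ⊕
    ((Fin N × Fin M) × Option (Fin K))

/-- The total number `d` of parameters. -/
def numParams (N M R K : ℕ) : ℕ := Fintype.card (ParamIdx N M R K)

/-- One affine node: bias plus weighted sum of the incoming coordinates. -/
def affine {α : Type} [Fintype α] (W : Option α → ℝ) (h : α → ℝ) : ℝ :=
  W none + ∑ j, W (some j) * h j

/-- Output of the hidden layers, which are numbered `0, …, R - 1`. -/
def hidden {N M R K : ℕ} (ω : ParamIdx N M R K → ℝ) (y : Profile N M) : ℕ → Fin K → ℝ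
  | 0 => fun k => max 0 (affine (fun j => ω (Sum.inl (k, j))) (netInput y))
  | n + 1 => fun k =>
      if hn : n < R - 1 then
        max 0 (affine (fun j => ω (Sum.inr (Sum.inl (⟨n, hn⟩, k, j)))) (hidden ω y n))
      else 0

/-- The network `z_ω`. -/
def network {N M R K : ℕ} (ω : ParamIdx N M R K → ℝ) (y : Profile N M) : Alloc N M :=
  fun i m => affine (fun j => ω (Sum.inr (Sum.inr ((i, m), j)))) (hidden ω y (R - 1))

/-- Parameter vectors with `‖ω‖₁ ≤ Ω`. -/
def paramBall (N M R K : ℕ) (Ω : ℝ) : Set (ParamIdx N M R K → ℝ) :=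
  {ω | ∑ p, |ω p| ≤ Ω}

/-! ### The regularized proportional fairness activation -/

open Classical in
/-- `-∑ i, w i * log (a i ⬝ v i) + ⟨a, z⟩`, with value `+∞` where the logarithm of a
nonpositive number would occur with a nonzero weight. -/
def rpfObjective {N M : ℕ} (w : Fin N → ℝ) (v z a : Alloc N M) : EReal :=
  if ∀ i, w i ≠ 0 → 0 < ∑ m, a i m * v i m then
    ((-(∑ i, w i * Real.log (∑ m, a i m * v i m)) + ∑ i, ∑ m, a i m * z i m : ℝ) : EReal)
  else ⊤

/-- `act y z` is, for each profile `y` in `Y`, a solution of the regularized proportional fairness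
program with linear regularizer `z` (the program can have several solutions; `act` selects one). -/
def IsRPFActivation {N M : ℕ} (w : Fin N → ℝ) (Y : Set (Profile N M))
    (act : Profile N M → Alloc N M → Alloc N M) : Prop :=
  ∀ y ∈ Y, ∀ z, act y z ∈ feasibleSet y ∧ IsMinOn (rpfObjective w y.1 z) (feasibleSet y) (act y z)

/-- The mechanism `f_ω`: the activation applied to the network output. -/
def rpfMechanism {N M R K : ℕ} (act : Profile N M → Alloc N M → Alloc N M)
    (ω : ParamIdx N M R K → ℝ) (y : Profile N M) : Alloc N M :=
  act y (network ω y)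

/-- On the outputs of networks with `‖ω‖₁ ≤ Ω`, the activation is `Φ`-Lipschitz for `ℓ¹` norms. -/
def LipschitzActivation {N M : ℕ} (R K : ℕ) (Y : Set (Profile N M)) (Ω Φ : ℝ)
    (act : Profile N M → Alloc N M → Alloc N M) : Prop :=
  ∀ y ∈ Y, ∀ ω ∈ paramBall N M R K Ω, ∀ ω' ∈ paramBall N M R K Ω,
    ∑ i, ∑ m, |act y (network ω y) i m - act y (network ω' y) i m| ≤
      Φ * ∑ i, ∑ m, |network ω y i m - network ω' y i m|

/-- For `F`-almost every profile, all utilities under all networks with `‖ω‖₁ ≤ Ω` lie in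
`[1/ψ, ψ]`, and each agent's value of every subset of the resources is at most `1`. -/
def BoundedUtilities {N M : ℕ} (R K : ℕ) (F : Measure (Profile N M)) (Ω ψ : ℝ)
    (act : Profile N M → Alloc N M → Alloc N M) : Prop :=
  ∀ᵐ y ∂F, ∀ i,
    (∀ ω ∈ paramBall N M R K Ω,
      1 / ψ ≤ utility (rpfMechanism act ω y) y.1 y.2.1 i ∧
        utility (rpfMechanism act ω y) y.1 y.2.1 i ≤ ψ) ∧
    ∀ S : Finset (Fin M), ∑ m ∈ S, y.1 i m ≤ 1

/-! ### Generalization errors on a sample `s` of size `L` -/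

def genErrLogNSW {N M L : ℕ} (w : Fin N → ℝ) (F : Measure (Profile N M))
    (f : Profile N M → Alloc N M) (s : Fin L → Profile N M) : ℝ :=
  -(∫ y, logNSW w f y ∂F) + (1 / (L : ℝ)) * ∑ l, logNSW w f (s l)

def genErrExpl {N M L : ℕ} (V D : Set (Alloc N M)) (F : Measure (Profile N M))
    (f : Profile N M → Alloc N M) (i : Fin N) (s : Fin L → Profile N M) : ℝ :=
  (∫ y, expl V D f i y ∂F) - (1 / (L : ℝ)) * ∑ l, expl V D f i (s l)

end

end RPFNet

/-! The proof is a one-step covering argument in parameter space, with no symmetrization. Hidden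
layers amplify a parameter change by a factor exponential in `R`, so the welfare and exploitability
of `f_ω` are Lipschitz in `ω` (`sum_abs_network_sub_le`, the assumption on the activation,
`abs_logNSW_sub_le`, `abs_expl_sub_le`). With `A = LNΩΦ max{K, MN}`, an `ℓ¹` net of radius `Ω / A ^
(7R)` therefore moves every objective by only `O(ψ / L)`.

Such a net has `exp (O(R d log A))` points (`exists_l1_net`). Hoeffding's inequality at each net
point for each of the `N + 1` objectives, whose range is `O(N (1 + log ψ))`, and a union bound give
the two square roots (`measure_uniform_deviation_le`). The discretization error is absorbed into the
first one.

Misreported profiles may form an `F`-null set. Estimates for exploitability therefore use only what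
holds on all of `V ×ˢ D ×ˢ B`, together with the almost sure bounds at the true profile. -/

namespace RPFNet

/-! ### ### Covering numbers -/

open Metric Module in
/-- Volumetric bound on the size of an `ε`-separated subset of a ball. -/
theorem card_le_of_separated {E : Type*} [NormedAddCommGroup E] [NormedSpace ℝ E]
    [FiniteDimensional ℝ E] {r ε : ℝ} (hr : 0 < r) (hε : 0 < ε) (s : Finset E)
    (hs : ∀ c ∈ s, ‖c‖ ≤ r) (h : ∀ c ∈ s, ∀ d ∈ s, c ≠ d → ε ≤ ‖c - d‖) :
    (s.card : ℝ) ≤ (1 + 2 * (r / ε)) ^ finrank ℝ E := by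
  borelize E
  let μ : Measure E := Measure.addHaar
  have hε2 : 0 < ε / 2 := by positivity
  have hρ : 0 < r + ε / 2 := by positivity
  -- Disjoint balls of radius `ε / 2` are packed into one of radius `r + ε / 2`, and Haar volumes
  -- are compared.
  have hdisj : Set.Pairwise (s : Set E) (Function.onFun Disjoint fun c => ball (c : E) (ε / 2)) := by
    intro c hc d hd hcd
    apply ball_disjoint_ball
    rw [dist_eq_norm, add_halves]
    exact h c hc d hd hcd
  have hsub : (⋃ c ∈ s, ball (c : E) (ε / 2)) ⊆ ball (0 : E) (r + ε / 2) := by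
    refine Set.iUnion₂_subset fun x hx => ball_subset_ball' ?_
    rw [dist_zero_right]
    linarith [hs x hx]
  have hvol : (s.card : ENNReal) * ENNReal.ofReal ((ε / 2) ^ finrank ℝ E) * μ (ball 0 1) ≤
      ENNReal.ofReal ((r + ε / 2) ^ finrank ℝ E) * μ (ball 0 1) :=
    calc
      (s.card : ENNReal) * ENNReal.ofReal ((ε / 2) ^ finrank ℝ E) * μ (ball 0 1)
          = μ (⋃ c ∈ s, ball (c : E) (ε / 2)) := by
        rw [measure_biUnion_finset hdisj fun c _ => measurableSet_ball]
        simp only [μ.addHaar_ball_of_pos _ hε2]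
        simp only [Finset.sum_const, nsmul_eq_mul, mul_assoc]
      _ ≤ μ (ball (0 : E) (r + ε / 2)) := measure_mono hsub
      _ = _ := by simp only [μ.addHaar_ball_of_pos _ hρ]
  have hcard : (s.card : ENNReal) * ENNReal.ofReal ((ε / 2) ^ finrank ℝ E) ≤
      ENNReal.ofReal ((r + ε / 2) ^ finrank ℝ E) :=
    (ENNReal.mul_le_mul_iff_left (measure_ball_pos _ _ zero_lt_one).ne'
      measure_ball_lt_top.ne).1 hvol
  have hreal := ENNReal.toReal_le_of_le_ofReal (pow_nonneg hρ.le _) hcard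
  rw [ENNReal.toReal_mul, ENNReal.toReal_natCast, ENNReal.toReal_ofReal (by positivity)] at hreal
  have heq : (1 + 2 * (r / ε)) = (r + ε / 2) / (ε / 2) := by field_simp; ring
  rw [heq, div_pow, le_div_iff₀ (by positivity)]
  exact hreal

open Module in
/-- A ball of radius `r` in a normed space of dimension `d` has an internal `ε`-net with at most
`(1 + 2 r / ε) ^ d` points. -/
theorem exists_net {E : Type*} [NormedAddCommGroup E] [NormedSpace ℝ E]
    [FiniteDimensional ℝ E] {r ε : ℝ} (hr : 0 < r) (hε : 0 < ε) :
    ∃ s : Finset E, (∀ c ∈ s, ‖c‖ ≤ r) ∧ (∀ x, ‖x‖ ≤ r → ∃ c ∈ s, ‖x - c‖ ≤ ε) ∧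
      (s.card : ℝ) ≤ (1 + 2 * (r / ε)) ^ finrank ℝ E := by
  classical
  -- A separated set of greatest size is a net: an uncovered point could be added to it. The volume
  -- bound makes a greatest size exist.
  let P : ℕ → Prop := fun n => ∃ s : Finset E, (∀ c ∈ s, ‖c‖ ≤ r) ∧
    (∀ c ∈ s, ∀ d ∈ s, c ≠ d → ε ≤ ‖c - d‖) ∧ s.card = n
  have hP0 : P 0 := ⟨∅, by simp, by simp, rfl⟩
  have hbd : ∀ n, P n → n ≤ ⌊(1 + 2 * (r / ε)) ^ finrank ℝ E⌋₊ := by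
    rintro n ⟨s, h1, h2, rfl⟩
    exact Nat.le_floor (card_le_of_separated hr hε s h1 h2)
  obtain ⟨s, h1, h2, h3⟩ := Nat.findGreatest_spec (P := P) (Nat.zero_le
    ⌊(1 + 2 * (r / ε)) ^ finrank ℝ E⌋₊) hP0
  refine ⟨s, h1, fun x hx => ?_, card_le_of_separated hr hε s h1 h2⟩
  by_contra! hcon
  have hxs : x ∉ s := fun hxs => by
    have := hcon x hxs
    rw [sub_self, norm_zero] at this
    linarith
  have hins : P (s.card + 1) := by
    refine ⟨insert x s, ?_, ?_, Finset.card_insert_of_notMem hxs⟩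
    · intro c hc
      rcases Finset.mem_insert.1 hc with rfl | hc
      exacts [hx, h1 c hc]
    · intro c hc d hd hcd
      rcases Finset.mem_insert.1 hc with rfl | hcs <;> rcases Finset.mem_insert.1 hd with rfl | hds
      · exact absurd rfl hcd
      · exact (hcon d hds).le
      · rw [norm_sub_rev]; exact (hcon c hcs).le
      · exact h2 c hcs d hds hcd
  have := Nat.le_findGreatest (hbd _ hins) hins
  omega

/-- The `ℓ¹` ball of `ι → ℝ` has an internal net of size exponential in the dimension. -/
theorem exists_l1_net {ι : Type*} [Fintype ι] {r ε : ℝ} (hr : 0 < r) (hε : 0 < ε) :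
    ∃ s : Finset (ι → ℝ), (∀ c ∈ s, ∑ p, |c p| ≤ r) ∧
      (∀ x : ι → ℝ, ∑ p, |x p| ≤ r → ∃ c ∈ s, ∑ p, |x p - c p| ≤ ε) ∧
      (s.card : ℝ) ≤ (1 + 2 * (r / ε)) ^ Fintype.card ι := by
  classical
  obtain ⟨s, h1, h2, h3⟩ := exists_net (E := PiLp 1 fun _ : ι => ℝ) hr hε
  have hnorm : ∀ x : PiLp 1 fun _ : ι => ℝ, ‖x‖ = ∑ p, |x p| := fun x => by
    simp [PiLp.norm_eq_of_nat 1 (by norm_num) x]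
  refine ⟨s.image WithLp.ofLp, ?_, ?_, ?_⟩
  · intro c hc
    obtain ⟨c, hcs, rfl⟩ := Finset.mem_image.1 hc
    simpa [hnorm] using h1 c hcs
  · intro x hx
    obtain ⟨c, hc, hxc⟩ := h2 (WithLp.toLp 1 x) (by simpa [hnorm] using hx)
    exact ⟨c.ofLp, Finset.mem_image_of_mem _ hc, by simpa [hnorm] using hxc⟩
  · have hfin : Module.finrank ℝ (PiLp 1 fun _ : ι => ℝ) = Fintype.card ι := by
      rw [(WithLp.linearEquiv 1 ℝ (ι → ℝ)).finrank_eq, Module.finrank_fintype_fun_eq_card]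
    rw [hfin] at h3
    exact le_trans (by exact_mod_cast Finset.card_image_le) h3

/-! ### ### Concentration -/

/-- Hoeffding's inequality for the empirical mean of a function bounded by `c`. -/
theorem measure_integral_sub_mean_ge_le {α : Type*} [MeasurableSpace α] (F : Measure α)
    [IsProbabilityMeasure F] {L : ℕ} (hL : 1 ≤ L) {g : α → ℝ} (hg : AEMeasurable g F) {c : ℝ}
    (hc : 0 < c) (hb : ∀ᵐ y ∂F, |g y| ≤ c) {t : ℝ} (ht : 0 ≤ t) :
    Measure.pi (fun _ : Fin L => F) {s | t ≤ (∫ y, g y ∂F) - (1 / (L : ℝ)) * ∑ l, g (s l)} ≤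
      ENNReal.ofReal (Real.exp (-(L * t ^ 2 / (2 * c ^ 2)))) := by
  have hL0 : (0 : ℝ) < L := by exact_mod_cast hL
  -- Negating `g` turns the wanted lower tail into an upper tail; the range `[-c, c]` gives variance
  -- proxy `c ^ 2`.
  have hsub : ProbabilityTheory.HasSubgaussianMGF (fun y => -g y - ∫ y, -g y ∂F)
      ((‖c - (-c)‖₊ / 2) ^ 2) F :=
    ProbabilityTheory.hasSubgaussianMGF_of_mem_Icc hg.neg
      (hb.mono fun y hy => ⟨neg_le_neg (abs_le.1 hy).2, neg_le.1 (abs_le.1 hy).1⟩)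
  have hindep : ProbabilityTheory.iIndepFun
      (fun (l : Fin L) (s : Fin L → α) => -g (s l) - ∫ y, -g y ∂F) (Measure.pi fun _ => F) :=
    ProbabilityTheory.iIndepFun_pi (X := fun _ y => -g y - ∫ y, -g y ∂F)
      fun _ => hg.neg.sub_const _
  have hsubl : ∀ l ∈ (Finset.univ : Finset (Fin L)), ProbabilityTheory.HasSubgaussianMGF
      (fun s : Fin L → α => -g (s l) - ∫ y, -g y ∂F) ((‖c - (-c)‖₊ / 2) ^ 2)
      (Measure.pi fun _ => F) := by
    intro l _
    have hmp := measurePreserving_eval (fun _ : Fin L => F) l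
    refine ProbabilityTheory.HasSubgaussianMGF.of_map (Y := Function.eval l)
      (X := fun y => -g y - ∫ y, -g y ∂F) hmp.measurable.aemeasurable ?_
    rw [hmp.map_eq]
    exact hsub
  have hmain := ProbabilityTheory.HasSubgaussianMGF.measure_sum_ge_le_of_iIndepFun hindep hsubl
    (ε := L * t) (by positivity)
  have hexp : -(L * t) ^ 2 / (2 * ((∑ _l : Fin L, (‖c - (-c)‖₊ / 2) ^ 2 : NNReal) : ℝ)) =
      -(L * t ^ 2 / (2 * c ^ 2)) := by
    have hn : ‖c - -c‖ = 2 * c := by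
      rw [Real.norm_eq_abs, abs_of_pos (by linarith)]; ring
    push_cast
    rw [hn]
    simp only [Finset.sum_const, Finset.card_univ, Fintype.card_fin, nsmul_eq_mul]
    field_simp
  have hset : {s : Fin L → α | t ≤ (∫ y, g y ∂F) - (1 / (L : ℝ)) * ∑ l, g (s l)} =
      {s | L * t ≤ ∑ l, (-g (s l) - ∫ y, -g y ∂F)} := by
    ext s
    simp only [Set.mem_ofPred_eq, Finset.sum_sub_distrib, Finset.sum_neg_distrib, integral_neg,
      Finset.sum_const, Finset.card_univ, Fintype.card_fin, nsmul_eq_mul]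
    rw [← mul_le_mul_iff_right₀ hL0]
    have : (L : ℝ) * ((∫ y, g y ∂F) - 1 / (L : ℝ) * ∑ l, g (s l)) =
        -∑ l, g (s l) - -(L * ∫ y, g y ∂F) := by field_simp; ring
    rw [this]
  rw [hset, ← ofReal_measureReal]
  apply ENNReal.ofReal_le_ofReal
  convert hmain using 2
  simpa using hexp.symm

/-- Uniform one-sided deviation bound for a family of bounded functions with a finite net. -/
theorem measure_uniform_deviation_le {α P ι : Type*} [MeasurableSpace α] [Fintype ι]
    (F : Measure α) [IsProbabilityMeasure F] {L : ℕ} (hL : 1 ≤ L) {S : Set P} (net : Finset P)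
    (hnet : ∀ q ∈ net, q ∈ S) {G : Set α} (hG : ∀ᵐ y ∂F, y ∈ G) {g : ι → P → α → ℝ}
    (hg : ∀ j, ∀ p ∈ S, AEMeasurable (g j p) F) {c : ℝ} (hc : 0 < c)
    (hb : ∀ j, ∀ p ∈ S, ∀ y ∈ G, |g j p y| ≤ c) {η : ℝ}
    (hη : ∀ p ∈ S, ∃ q ∈ net, ∀ j, ∀ y ∈ G, |g j p y - g j q y| ≤ η) {t : ℝ} (ht : 0 ≤ t) :
    Measure.pi (fun _ : Fin L => F) {s | ¬ ∀ p ∈ S, ∀ j,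
        (∫ y, g j p y ∂F) - (1 / (L : ℝ)) * ∑ l, g j p (s l) ≤ 2 * η + t} ≤
      ENNReal.ofReal (Fintype.card ι * net.card * Real.exp (-(L * t ^ 2 / (2 * c ^ 2)))) := by
  have hL0 : (0 : ℝ) < L := by exact_mod_cast hL
  have hint : ∀ j, ∀ p ∈ S, Integrable (g j p) F := fun j p hp =>
    Integrable.of_bound (hg j p hp).aestronglyMeasurable c (hG.mono fun y hy => hb j p hp y hy)
  have hGs : ∀ᵐ s ∂(Measure.pi fun _ : Fin L => F), ∀ l, s l ∈ G := by
    rw [ae_all_iff]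
    exact fun l => (Measure.quasiMeasurePreserving_eval (fun _ : Fin L => F) l).ae hG
  -- Passing from `p` to its net point costs `η` in the expectation and `η` in the empirical mean,
  -- hence `2 * η`.
  have hsub : {s : Fin L → α | ¬ ∀ p ∈ S, ∀ j,
        (∫ y, g j p y ∂F) - (1 / (L : ℝ)) * ∑ l, g j p (s l) ≤ 2 * η + t} ⊆
      {s | ¬ ∀ l, s l ∈ G} ∪ ⋃ jq ∈ (Finset.univ : Finset ι) ×ˢ net,
        {s | t ≤ (∫ y, g jq.1 jq.2 y ∂F) - (1 / (L : ℝ)) * ∑ l, g jq.1 jq.2 (s l)} := by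
    intro s hs
    by_cases hsG : ∀ l, s l ∈ G
    swap
    · exact Or.inl hsG
    right
    simp only [Set.mem_ofPred_eq, not_forall, not_le] at hs
    obtain ⟨p, hp, j, hlt⟩ := hs
    obtain ⟨q, hq, hpq⟩ := hη p hp
    simp only [Set.mem_iUnion, Set.mem_ofPred_eq]
    refine ⟨(j, q), Finset.mem_product.2 ⟨Finset.mem_univ _, hq⟩, ?_⟩
    have h1 : (∫ y, g j p y ∂F) ≤ (∫ y, g j q y ∂F) + η := by
      have : (∫ y, g j p y ∂F) ≤ ∫ y, (g j q y + η) ∂F := by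
        refine integral_mono_ae (hint j p hp) ((hint j q (hnet q hq)).add (integrable_const _)) ?_
        filter_upwards [hG] with y hy
        linarith [(abs_le.1 (hpq j y hy)).2]
      rwa [integral_add (hint j q (hnet q hq)) (integrable_const _), integral_const,
        probReal_univ, one_smul] at this
    have h2 : (1 / (L : ℝ)) * ∑ l, g j q (s l) ≤ (1 / (L : ℝ)) * ∑ l, g j p (s l) + η := by
      have : ∑ l, g j q (s l) ≤ ∑ l, (g j p (s l) + η) :=
        Finset.sum_le_sum fun l _ => by linarith [(abs_le.1 (hpq j _ (hsG l))).1]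
      rw [Finset.sum_add_distrib, Finset.sum_const, Finset.card_univ, Fintype.card_fin,
        nsmul_eq_mul] at this
      calc (1 / (L : ℝ)) * ∑ l, g j q (s l) ≤ (1 / (L : ℝ)) * (∑ l, g j p (s l) + L * η) := by
            gcongr
        _ = _ := by field_simp
    show t ≤ (∫ y, g j q y ∂F) - (1 / (L : ℝ)) * ∑ l, g j q (s l)
    linarith
  refine (measure_mono hsub).trans ((measure_union_le _ _).trans ?_)
  rw [ae_iff.1 hGs, zero_add]
  refine (measure_biUnion_finset_le _ _).trans ((Finset.sum_le_sum fun jq hjq =>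
    measure_integral_sub_mean_ge_le F hL (hg jq.1 jq.2 (hnet _ (Finset.mem_product.1 hjq).2)) hc
      (hG.mono fun y hy => hb jq.1 jq.2 (hnet _ (Finset.mem_product.1 hjq).2) y hy) ht).trans ?_)
  rw [Finset.sum_const, Finset.card_product, Finset.card_univ, nsmul_eq_mul,
    ENNReal.ofReal_mul (by positivity)]
  gcongr
  rw [← Nat.cast_mul, ENNReal.ofReal_natCast]

/-! ### Lipschitz dependence of the network on its parameters -/

theorem sum_comp_le_of_injective {α β : Type*} [Fintype α] [Fintype β] {e : α → β}
    (he : Function.Injective e) {f : β → ℝ} (hf : ∀ b, 0 ≤ f b) : ∑ a, f (e a) ≤ ∑ b, f b :=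
  (Finset.sum_map Finset.univ ⟨e, he⟩ f).symm.trans_le (Finset.sum_le_univ_sum_of_nonneg hf)

/-- The condition `1 ≤ B` lets the bias count as a weight on a constant input `1`. -/
theorem abs_affine_le {α : Type} [Fintype α] {W : Option α → ℝ} {h : α → ℝ} {B : ℝ}
    (hB : 1 ≤ B) (hh : ∀ j, |h j| ≤ B) : |affine W h| ≤ B * ∑ o, |W o| := by
  rw [Fintype.sum_option, mul_add, Finset.mul_sum]
  refine (abs_add_le _ _).trans (add_le_add (le_mul_of_one_le_left (abs_nonneg _) hB)
    ((Finset.abs_sum_le_sum_abs _ _).trans (Finset.sum_le_sum fun j _ => ?_)))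
  rw [abs_mul, mul_comm]
  exact mul_le_mul_of_nonneg_right (hh j) (abs_nonneg _)

/-- Change the weights at fixed input `h`, then the input at fixed weights `W'`; the bias drops out
of the second change. -/
theorem abs_affine_sub_le {α : Type} [Fintype α] {W W' : Option α → ℝ} {h h' : α → ℝ} {B D : ℝ}
    (hB : 1 ≤ B) (hD : 0 ≤ D) (hh : ∀ j, |h j| ≤ B) (hd : ∀ j, |h j - h' j| ≤ D) :
    |affine W h - affine W' h'| ≤ B * ∑ o, |W o - W' o| + D * ∑ o, |W' o| := by
  have hsplit : affine W h - affine W' h' =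
      affine (fun o => W o - W' o) h + ∑ j, W' (some j) * (h j - h' j) := by
    simp only [affine, sub_mul, mul_sub, Finset.sum_sub_distrib]
    ring
  rw [hsplit]
  refine (abs_add_le _ _).trans (add_le_add (abs_affine_le hB hh) ?_)
  refine (Finset.abs_sum_le_sum_abs _ _).trans ?_
  rw [Fintype.sum_option, mul_add, Finset.mul_sum]
  refine le_add_of_nonneg_of_le (by positivity) (Finset.sum_le_sum fun j _ => ?_)
  rw [abs_mul, mul_comm]
  exact mul_le_mul_of_nonneg_right (hd j) (abs_nonneg _)

theorem abs_relu_sub_le (a b : ℝ) : |max 0 a - max 0 b| ≤ |a - b| := by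
  simpa using abs_max_sub_max_le_max 0 a 0 b

theorem abs_relu_le (a : ℝ) : |max 0 a| ≤ |a| := by
  simpa using abs_relu_sub_le a 0

section Network

variable {N M R K : ℕ} {Ω H : ℝ} {ω ω' : ParamIdx N M R K → ℝ} {y : Profile N M}

/-- The weights into one node have `ℓ¹` mass at most `Ω`, so a layer multiplies the sup norm by a
factor independent of the width `K`. The base `2 + Ω` keeps the bound at least `1`. -/
theorem abs_hidden_le (hH : 1 ≤ H) (hy : ∀ j, |netInput y j| ≤ H)
    (hω : ω ∈ paramBall N M R K Ω) (n : ℕ) (k : Fin K) :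
    |hidden ω y n k| ≤ H * (2 + Ω) ^ (n + 1) := by
  have hsum : ∑ p, |ω p| ≤ Ω := hω
  have hΩ : 0 ≤ Ω := le_trans (Finset.sum_nonneg fun p _ => abs_nonneg _) hsum
  have hnode : ∀ {α : Type} [Fintype α] (e : Option α → ParamIdx N M R K)
      (_ : Function.Injective e), ∑ o, |ω (e o)| ≤ Ω := fun e he =>
    (sum_comp_le_of_injective he (f := fun p => |ω p|) fun _ => abs_nonneg _).trans hsum
  induction n generalizing k with
  | zero =>
    rw [hidden]
    refine (abs_relu_le _).trans ((abs_affine_le hH hy).trans ?_)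
    rw [zero_add, pow_one]
    gcongr
    refine (hnode (fun j => Sum.inl (k, j)) fun a b h => by simpa using h).trans (by linarith)
  | succ n ih =>
    rw [hidden]
    split_ifs with hn
    · have hB : 1 ≤ H * (2 + Ω) ^ (n + 1) :=
        one_le_mul_of_one_le_of_one_le hH (one_le_pow₀ (by linarith))
      refine (abs_relu_le _).trans ((abs_affine_le hB ih).trans ?_)
      rw [pow_succ (2 + Ω) (n + 1), ← mul_assoc]
      gcongr
      refine (hnode (fun j => Sum.inr (Sum.inl (⟨n, hn⟩, k, j)))
        fun a b h => by simpa using h).trans (by linarith)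
    -- Layers past the last are `0` by default, so the induction needs no bound on `n`.
    · simp only [abs_zero]
      positivity

/-- If `B` bounds a layer and `B * Δ` its variation, the next layer varies by at most `B * Δ + B * Δ
* Ω`, within `B * (2 + Ω) * Δ`. -/
theorem abs_hidden_sub_le (hH : 1 ≤ H) (hy : ∀ j, |netInput y j| ≤ H)
    (hω : ω ∈ paramBall N M R K Ω) (hω' : ω' ∈ paramBall N M R K Ω) (n : ℕ) (k : Fin K) :
    |hidden ω y n k - hidden ω' y n k| ≤ H * (2 + Ω) ^ (n + 1) * ∑ p, |ω p - ω' p| := by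
  have hsum : ∑ p, |ω' p| ≤ Ω := hω'
  have hΩ : 0 ≤ Ω := le_trans (Finset.sum_nonneg fun p _ => abs_nonneg _) hsum
  set Δ := ∑ p, |ω p - ω' p| with hΔ
  have hΔ0 : 0 ≤ Δ := Finset.sum_nonneg fun p _ => abs_nonneg _
  have hnode : ∀ {α : Type} [Fintype α] (e : Option α → ParamIdx N M R K)
      (_ : Function.Injective e), ∑ o, |ω (e o) - ω' (e o)| ≤ Δ ∧ ∑ o, |ω' (e o)| ≤ Ω :=
    fun e he => ⟨sum_comp_le_of_injective he (f := fun p => |ω p - ω' p|) fun _ => abs_nonneg _,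
      (sum_comp_le_of_injective he (f := fun p => |ω' p|) fun _ => abs_nonneg _).trans hsum⟩
  induction n generalizing k with
  | zero =>
    rw [hidden, hidden]
    refine (abs_relu_sub_le _ _).trans ((abs_affine_sub_le hH le_rfl hy (by simp)).trans ?_)
    rw [zero_add, pow_one, zero_mul, add_zero, mul_assoc]
    gcongr
    refine (hnode (fun j => Sum.inl (k, j)) fun a b h => by simpa using h).1.trans ?_
    nlinarith
  | succ n ih =>
    rw [hidden, hidden]
    split_ifs with hn
    · have hB : 1 ≤ H * (2 + Ω) ^ (n + 1) :=
        one_le_mul_of_one_le_of_one_le hH (one_le_pow₀ (by linarith))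
      have he := hnode (fun j => Sum.inr (Sum.inl (⟨n, hn⟩, k, j))) fun a b h => by simpa using h
      refine (abs_relu_sub_le _ _).trans ((abs_affine_sub_le hB (by positivity)
        (abs_hidden_le hH hy hω n) ih).trans ?_)
      calc _ ≤ H * (2 + Ω) ^ (n + 1) * Δ + H * (2 + Ω) ^ (n + 1) * Δ * Ω :=
            add_le_add (mul_le_mul_of_nonneg_left he.1 (by positivity))
              (mul_le_mul_of_nonneg_left he.2 (by positivity))
        _ = H * (2 + Ω) ^ (n + 1) * Δ * (1 + Ω) := by ring
        _ ≤ H * (2 + Ω) ^ (n + 1) * Δ * (2 + Ω) := by gcongr; norm_num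
        _ = _ := by ring
    · simp only [sub_zero, abs_zero]
      positivity

/-- Different outputs use disjoint sets of parameters, so summing over all of them costs no factor
`N * M`. -/
theorem sum_abs_network_sub_le (hR : 1 ≤ R) (hH : 1 ≤ H) (hy : ∀ j, |netInput y j| ≤ H)
    (hω : ω ∈ paramBall N M R K Ω) (hω' : ω' ∈ paramBall N M R K Ω) :
    ∑ i, ∑ m, |network ω y i m - network ω' y i m| ≤
      H * (2 + Ω) ^ (R + 1) * ∑ p, |ω p - ω' p| := by
  have hsum : ∑ p, |ω' p| ≤ Ω := hω'
  have hΩ : 0 ≤ Ω := le_trans (Finset.sum_nonneg fun p _ => abs_nonneg _) hsum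
  obtain ⟨r, rfl⟩ : ∃ r, R = r + 1 := ⟨R - 1, by omega⟩
  set Δ := ∑ p, |ω p - ω' p| with hΔ
  have hΔ0 : 0 ≤ Δ := Finset.sum_nonneg fun p _ => abs_nonneg _
  set B := H * (2 + Ω) ^ (r + 1) with hBdef
  have hB : 1 ≤ B := one_le_mul_of_one_le_of_one_le hH (one_le_pow₀ (by linarith))
  have hinj : Function.Injective fun q : (Fin N × Fin M) × Option (Fin K) =>
      (Sum.inr (Sum.inr q) : ParamIdx N M (r + 1) K) := fun a b h => by simpa using h
  have h1 := sum_comp_le_of_injective hinj (f := fun p => |ω p - ω' p|) fun _ => abs_nonneg _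
  have h2 := (sum_comp_le_of_injective hinj (f := fun p => |ω' p|) fun _ => abs_nonneg _).trans hsum
  rw [Fintype.sum_prod_type, Fintype.sum_prod_type] at h1 h2
  calc ∑ i, ∑ m, |network ω y i m - network ω' y i m|
      ≤ ∑ i, ∑ m, (B * ∑ o, |ω (Sum.inr (Sum.inr ((i, m), o))) - ω' (Sum.inr (Sum.inr ((i, m), o)))|
          + B * Δ * ∑ o, |ω' (Sum.inr (Sum.inr ((i, m), o)))|) :=
        Finset.sum_le_sum fun i _ => Finset.sum_le_sum fun m _ =>
          abs_affine_sub_le hB (by positivity) (abs_hidden_le hH hy hω r)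
            (abs_hidden_sub_le hH hy hω hω' r)
    _ ≤ B * Δ + B * Δ * Ω := by
        simp only [Finset.sum_add_distrib, ← Finset.mul_sum]
        exact add_le_add (mul_le_mul_of_nonneg_left h1 (by positivity))
          (mul_le_mul_of_nonneg_left h2 (by positivity))
    _ = B * Δ * (1 + Ω) := by ring
    _ ≤ B * Δ * (2 + Ω) := by gcongr; norm_num
    _ = _ := by rw [hBdef]; ring

end Network

/-! ### Welfare and exploitability as functions of the allocation -/

section Objectives

variable {N M : ℕ}

theorem abs_utility_sub_le {a a' v x : Alloc N M} {c : ℝ} (i : Fin N) (hv : ∀ m, |v i m| ≤ c) :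
    |utility a v x i - utility a' v x i| ≤ c * ∑ m, |a i m - a' i m| := by
  rw [utility, utility, ← Finset.sum_sub_distrib, Finset.mul_sum]
  refine (Finset.abs_sum_le_sum_abs _ _).trans (Finset.sum_le_sum fun m _ => ?_)
  rw [← mul_sub, abs_mul]
  refine mul_le_mul (hv m) ?_ (abs_nonneg _) ((abs_nonneg _).trans (hv m))
  simpa using abs_min_sub_min_le_max (a i m) (x i m) (a' i m) (x i m)

/-- Apply `log t ≤ t - 1` at `t = a / b`. This is the source of the factor `ψ` in the Lipschitz
estimate for welfare. -/
theorem log_sub_log_le {a b ψ : ℝ} (hψ : 0 < ψ) (ha : 0 < a) (hb : 1 / ψ ≤ b) :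
    Real.log a - Real.log b ≤ ψ * |a - b| := by
  have hb0 : 0 < b := lt_of_lt_of_le (by positivity) hb
  rw [← Real.log_div ha.ne' hb0.ne']
  calc Real.log (a / b) ≤ a / b - 1 := Real.log_le_sub_one_of_pos (by positivity)
    _ = (a - b) * (1 / b) := by field_simp
    _ ≤ |a - b| * (1 / b) := by gcongr; exact le_abs_self _
    _ ≤ |a - b| * ψ := by gcongr; rwa [one_div_le hb0 hψ]
    _ = ψ * |a - b| := mul_comm _ _

theorem abs_log_sub_log_le {a b ψ : ℝ} (hψ : 0 < ψ) (ha : 1 / ψ ≤ a) (hb : 1 / ψ ≤ b) :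
    |Real.log a - Real.log b| ≤ ψ * |a - b| := by
  have h0 : 0 < 1 / ψ := by positivity
  refine abs_le.2 ⟨?_, log_sub_log_le hψ (h0.trans_le ha) hb⟩
  have := log_sub_log_le hψ (h0.trans_le hb) ha
  rw [abs_sub_comm] at this
  linarith

theorem logNSW_eq_sum {w : Fin N → ℝ} {f : Profile N M → Alloc N M} {y : Profile N M}
    (hu : ∀ i, 0 < utility (f y) y.1 y.2.1 i) :
    logNSW w f y = ∑ i, w i * Real.log (utility (f y) y.1 y.2.1 i) := by
  rw [logNSW, NSW, Real.log_prod fun i _ => (Real.rpow_pos_of_pos (hu i) _).ne']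
  exact Finset.sum_congr rfl fun i _ => Real.log_rpow (hu i) _

theorem abs_logNSW_le {w : Fin N → ℝ} {f : Profile N M → Alloc N M} {y : Profile N M}
    {ψ W : ℝ} (hψ : 1 < ψ) (hw : ∀ i, w i ∈ Set.Icc 0 W)
    (hu : ∀ i, 1 / ψ ≤ utility (f y) y.1 y.2.1 i ∧ utility (f y) y.1 y.2.1 i ≤ ψ) :
    |logNSW w f y| ≤ N * (W * Real.log ψ) := by
  have hψ0 : 0 < ψ := by linarith
  have h0 : 0 < 1 / ψ := by positivity
  rw [logNSW_eq_sum fun i => h0.trans_le (hu i).1]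
  refine (Finset.abs_sum_le_sum_abs _ _).trans ((Finset.sum_le_card_nsmul _ _
    (W * Real.log ψ) fun i _ => ?_).trans_eq (by simp))
  rw [abs_mul, abs_of_nonneg (hw i).1]
  refine mul_le_mul (hw i).2 (abs_le.2 ⟨?_, Real.log_le_log (h0.trans_le (hu i).1) (hu i).2⟩)
    (abs_nonneg _) ((hw i).1.trans (hw i).2)
  rw [← Real.log_inv, ← one_div]
  exact Real.log_le_log h0 (hu i).1

theorem abs_logNSW_sub_le {w : Fin N → ℝ} {f f' : Profile N M → Alloc N M} {y : Profile N M}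
    {ψ W c : ℝ} (hψ : 1 < ψ) (hW : 0 ≤ W) (hw : ∀ i, w i ∈ Set.Icc 0 W) (hv : ∀ i m, |y.1 i m| ≤ c)
    (hu : ∀ i, 1 / ψ ≤ utility (f y) y.1 y.2.1 i)
    (hu' : ∀ i, 1 / ψ ≤ utility (f' y) y.1 y.2.1 i) :
    |logNSW w f y - logNSW w f' y| ≤ W * ψ * c * ∑ i, ∑ m, |f y i m - f' y i m| := by
  have hψ0 : 0 < ψ := by linarith
  have h0 : 0 < 1 / ψ := by positivity
  rw [logNSW_eq_sum fun i => h0.trans_le (hu i), logNSW_eq_sum fun i => h0.trans_le (hu' i),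
    ← Finset.sum_sub_distrib, Finset.mul_sum]
  refine (Finset.abs_sum_le_sum_abs _ _).trans (Finset.sum_le_sum fun i _ => ?_)
  rw [← mul_sub, abs_mul, abs_of_nonneg (hw i).1]
  calc _ ≤ W * (ψ * (c * ∑ m, |f y i m - f' y i m|)) := by
        refine mul_le_mul (hw i).2 ((abs_log_sub_log_le hψ0 (hu i) (hu' i)).trans ?_)
          (abs_nonneg _) hW
        exact mul_le_mul_of_nonneg_left (abs_utility_sub_le i (hv i)) hψ0.le
    _ = _ := by ring

/-- Truncation at the true demand does the work, so `a` need only be nonnegative. It may thus be an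
allocation feasible for a misreported profile. -/
theorem utility_mem_Icc {a v x : Alloc N M} {i : Fin N} {c : ℝ} (hc : 0 ≤ c)
    (hv : ∀ m, 0 ≤ v i m) (hv1 : ∑ m, v i m ≤ 1) (hx : ∀ m, x i m ∈ Set.Icc 0 c)
    (ha : ∀ m, 0 ≤ a i m) : utility a v x i ∈ Set.Icc 0 c := by
  refine ⟨Finset.sum_nonneg fun m _ => mul_nonneg (hv m) (le_min (ha m) (hx m).1), ?_⟩
  calc utility a v x i ≤ ∑ m, v i m * c := Finset.sum_le_sum fun m _ =>
        mul_le_mul_of_nonneg_left ((min_le_right _ _).trans (hx m).2) (hv m)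
    _ = (∑ m, v i m) * c := (Finset.sum_mul _ _ _).symm
    _ ≤ c := mul_le_of_le_one_left hc hv1

/-- The utilities agent `i` can obtain by misreporting. -/
def misreportUtilities (V D : Set (Alloc N M)) (f : Profile N M → Alloc N M) (i : Fin N)
    (y : Profile N M) : Set ℝ :=
  {t | ∃ v' x' : Fin M → ℝ, Function.update y.1 i v' ∈ V ∧ Function.update y.2.1 i x' ∈ D ∧
    t = utility (f (misreport y i v' x')) y.1 y.2.1 i}

variable {V D : Set (Alloc N M)} {B : Set (Fin M → ℝ)} {y : Profile N M} {i : Fin N} {c : ℝ}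

theorem misreportUtilities_nonempty (f : Profile N M → Alloc N M) (hy : y ∈ V ×ˢ D ×ˢ B) :
    (misreportUtilities V D f i y).Nonempty :=
  ⟨_, y.1 i, y.2.1 i, by simpa using hy.1, by simpa using hy.2.1, rfl⟩

theorem misreport_mem (hy : y ∈ V ×ˢ D ×ˢ B) {v' x' : Fin M → ℝ}
    (hv : Function.update y.1 i v' ∈ V) (hx : Function.update y.2.1 i x' ∈ D) :
    misreport y i v' x' ∈ V ×ˢ D ×ˢ B := ⟨hv, hx, hy.2.2⟩

theorem misreportUtilities_subset_Icc {f : Profile N M → Alloc N M} (hy : y ∈ V ×ˢ D ×ˢ B)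
    (hf : ∀ y ∈ V ×ˢ D ×ˢ B, f y ∈ feasibleSet y) (hc : 0 ≤ c) (hv : ∀ m, 0 ≤ y.1 i m)
    (hv1 : ∑ m, y.1 i m ≤ 1) (hx : ∀ m, y.2.1 i m ∈ Set.Icc 0 c) :
    misreportUtilities V D f i y ⊆ Set.Icc 0 c := by
  rintro t ⟨v', x', hv', hx', rfl⟩
  exact utility_mem_Icc hc hv hv1 hx fun m => ((hf _ (misreport_mem hy hv' hx')).1 i m).1

theorem abs_expl_le {f : Profile N M → Alloc N M} (hy : y ∈ V ×ˢ D ×ˢ B)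
    (hf : ∀ y ∈ V ×ˢ D ×ˢ B, f y ∈ feasibleSet y) (hc : 0 ≤ c) (hv : ∀ m, 0 ≤ y.1 i m)
    (hv1 : ∑ m, y.1 i m ≤ 1) (hx : ∀ m, y.2.1 i m ∈ Set.Icc 0 c) :
    |expl V D f i y| ≤ c := by
  have hsub := misreportUtilities_subset_Icc hy hf hc hv hv1 hx
  have hu := utility_mem_Icc hc hv hv1 hx fun m => ((hf y hy).1 i m).1
  have h1 : sSup (misreportUtilities V D f i y) ≤ c :=
    csSup_le (misreportUtilities_nonempty f hy) fun t ht => (hsub ht).2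
  have h2 : 0 ≤ sSup (misreportUtilities V D f i y) :=
    Real.sSup_nonneg fun t ht => (hsub ht).1
  show |sSup (misreportUtilities V D f i y) - utility (f y) y.1 y.2.1 i| ≤ c
  exact abs_sub_le_iff.2 ⟨by linarith [hu.1], by linarith [hu.2]⟩

/-- Both mechanisms are compared at the same misreport, while the utility keeps the true `v` and
`x`. -/
theorem sSup_misreportUtilities_le {f f' : Profile N M → Alloc N M} {e : ℝ}
    (hy : y ∈ V ×ˢ D ×ˢ B) (hf' : BddAbove (misreportUtilities V D f' i y))
    (he : ∀ y' ∈ V ×ˢ D ×ˢ B,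
      utility (f y') y.1 y.2.1 i ≤ utility (f' y') y.1 y.2.1 i + e) :
    sSup (misreportUtilities V D f i y) ≤ sSup (misreportUtilities V D f' i y) + e := by
  refine csSup_le (misreportUtilities_nonempty f hy) ?_
  rintro t ⟨v', x', hv', hx', rfl⟩
  have := le_csSup hf' ⟨v', x', hv', hx', rfl⟩
  linarith [he _ (misreport_mem hy hv' hx')]

/-- One `e` comes from the supremum, the other from the truthful utility. -/
theorem abs_expl_sub_le {f f' : Profile N M → Alloc N M} {e : ℝ} (hy : y ∈ V ×ˢ D ×ˢ B)
    (hf : BddAbove (misreportUtilities V D f i y)) (hf' : BddAbove (misreportUtilities V D f' i y))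
    (he : ∀ y' ∈ V ×ˢ D ×ˢ B,
      |utility (f y') y.1 y.2.1 i - utility (f' y') y.1 y.2.1 i| ≤ e) :
    |expl V D f i y - expl V D f' i y| ≤ 2 * e := by
  have h1 := sSup_misreportUtilities_le (f := f) hy hf' fun y' hy' => by
    linarith [(abs_le.1 (he y' hy')).2]
  have h2 := sSup_misreportUtilities_le (f := f') hy hf fun y' hy' => by
    linarith [(abs_le.1 (he y' hy')).1]
  have h3 := abs_le.1 (he y hy)
  show |(sSup (misreportUtilities V D f i y) - utility (f y) y.1 y.2.1 i) -
    (sSup (misreportUtilities V D f' i y) - utility (f' y) y.1 y.2.1 i)| ≤ 2 * e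
  exact abs_le.2 ⟨by linarith [h3.1, h3.2], by linarith [h3.1, h3.2]⟩

end Objectives

/-! ### Size of the net and of the deviation -/

/-- Of the exponent `7 * R`, the part `6 * R` pays for the network, by `2 + Ω ≤ A ^ 3` and `R + 1 ≤
2 * R`. The remaining `A ^ R ≥ A` pays for `L * Ω * Φ`. -/
theorem lipschitz_mul_resolution_le {A Ω Φ L : ℝ} {R : ℕ} (hR : 1 ≤ R) (hA : 2 ≤ A) (hL : 0 < L)
    (hΩ : 0 < Ω) (hΩA : Ω ≤ A) (hΦ : 0 ≤ Φ) (hLA : L * Ω * Φ ≤ A) :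
    Φ * ((2 + Ω) ^ (R + 1) * (Ω / A ^ (7 * R))) ≤ 1 / L := by
  have hA0 : 0 < A := by linarith
  have hbase : 2 + Ω ≤ A ^ 3 := by nlinarith [sq_nonneg (A - 2), mul_pos hA0 hA0]
  have hpow : (2 + Ω) ^ (R + 1) ≤ A ^ (6 * R) :=
    calc (2 + Ω) ^ (R + 1) ≤ (A ^ 3) ^ (R + 1) := by gcongr
      _ = A ^ (3 * (R + 1)) := (pow_mul _ _ _).symm
      _ ≤ A ^ (6 * R) := pow_le_pow_right₀ (by linarith) (by omega)
  have hsplit : A ^ (6 * R) * A ≤ A ^ (7 * R) := by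
    rw [← pow_succ]
    exact pow_le_pow_right₀ (by linarith) (by omega)
  rw [le_div_iff₀ hL]
  calc Φ * ((2 + Ω) ^ (R + 1) * (Ω / A ^ (7 * R))) * L
      = (2 + Ω) ^ (R + 1) * (L * Ω * Φ) / A ^ (7 * R) := by ring
    _ ≤ A ^ (6 * R) * A / A ^ (7 * R) := by gcongr
    _ ≤ 1 := div_le_one_of_le₀ hsplit (by positivity)

/-- The exponent `10` is `1` for the `N + 1 ≤ 2 ^ N` objectives plus `9` for the net, where `A ^ 2 ≥
4` absorbs `1 + 2 * _`. -/
theorem card_mul_net_le {A : ℝ} {N R d : ℕ} (hR : 1 ≤ R) (hA : 2 ≤ A) (hNd : N ≤ d) {n : ℝ}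
    (hn : n ≤ (1 + 2 * A ^ (7 * R)) ^ d) :
    ((N + 1 : ℕ) : ℝ) * n ≤ Real.exp (10 * (R * d * Real.log A)) := by
  have hA0 : 0 < A := by linarith
  have hA1 : 1 ≤ A := by linarith
  have hN : ((N + 1 : ℕ) : ℝ) ≤ A ^ (R * d) :=
    calc ((N + 1 : ℕ) : ℝ) ≤ ((2 ^ N : ℕ) : ℝ) := by exact_mod_cast Nat.lt_two_pow_self
      _ = 2 ^ N := by push_cast; rfl
      _ ≤ A ^ N := by gcongr
      _ ≤ A ^ (R * d) := pow_le_pow_right₀ hA1 (hNd.trans (Nat.le_mul_of_pos_left d hR))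
  have hT : 1 + 2 * A ^ (7 * R) ≤ A ^ (9 * R) :=
    calc 1 + 2 * A ^ (7 * R) ≤ A ^ 2 * A ^ (7 * R) := by
          have h1 := one_le_pow₀ hA1 (n := 7 * R)
          have h2 : 4 * A ^ (7 * R) ≤ A ^ 2 * A ^ (7 * R) := by gcongr; nlinarith
          linarith
      _ = A ^ (2 + 7 * R) := (pow_add _ _ _).symm
      _ ≤ A ^ (9 * R) := pow_le_pow_right₀ hA1 (by omega)
  calc ((N + 1 : ℕ) : ℝ) * n ≤ A ^ (R * d) * (A ^ (9 * R)) ^ d := by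
        refine mul_le_mul_of_nonneg hN (hn.trans ?_) (by positivity) (by positivity)
        gcongr
    _ = A ^ (10 * (R * d)) := by ring
    _ = Real.exp (10 * (R * d * Real.log A)) := by
        rw [← Real.exp_log (pow_pos hA0 _), Real.log_pow]
        push_cast
        ring_nf

/-- The coefficients work because `5 ^ 2 / 2 ≥ 10` beats the union bound and `2 ^ 2 / 2 ≥ 1` leaves
`δ`; the cross term is nonnegative. -/
theorem exp_mul_exp_deviation_le {X L δ c : ℝ} (hX : 0 ≤ X) (hL : 0 < L) (hδ : 0 < δ) (hδ1 : δ < 1)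
    (hc : 0 < c) :
    Real.exp (10 * X) * Real.exp (-(L * (c * (5 * Real.sqrt (X / L) +
      2 * Real.sqrt (Real.log (1 / δ) / L))) ^ 2 / (2 * c ^ 2))) ≤ δ := by
  have hlog : 0 ≤ Real.log (1 / δ) := Real.log_nonneg ((one_le_div hδ).2 hδ1.le)
  set a := Real.sqrt (X / L)
  set b := Real.sqrt (Real.log (1 / δ) / L)
  have ha : L * a ^ 2 = X := by rw [Real.sq_sqrt (by positivity)]; field_simp
  have hb : L * b ^ 2 = Real.log (1 / δ) := by rw [Real.sq_sqrt (by positivity)]; field_simp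
  have hab : 0 ≤ L * (a * b) := by positivity
  have heq : L * (c * (5 * a + 2 * b)) ^ 2 / (2 * c ^ 2) =
      (25 * (L * a ^ 2) + 20 * (L * (a * b)) + 4 * (L * b ^ 2)) / 2 := by
    field_simp
    ring
  rw [← Real.exp_add, heq, ha, hb]
  refine (Real.exp_le_exp.2 (?_ : _ ≤ -Real.log (1 / δ))).trans_eq ?_
  · linarith
  · rw [one_div, Real.log_inv, neg_neg, Real.exp_log hδ]

theorem one_div_le_two_mul_sqrt {X : ℝ} {L : ℕ} (hX : 1 / 2 ≤ X) (hL : 1 ≤ L) :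
    1 / (L : ℝ) ≤ 2 * Real.sqrt (X / L) := by
  have hL0 : (1 : ℝ) ≤ L := by exact_mod_cast hL
  have h : 1 / (2 * (L : ℝ)) ≤ Real.sqrt (X / L) := by
    apply Real.le_sqrt_of_sq_le
    rw [div_pow, div_le_div_iff₀ (by positivity) (by positivity)]
    nlinarith [mul_nonneg (sub_nonneg.2 hX) (sq_nonneg (L : ℝ))]
  calc 1 / (L : ℝ) = 2 * (1 / (2 * (L : ℝ))) := by field_simp
    _ ≤ _ := by gcongr

/-- The inequality `1 + log ψ ≤ ψ` merges the complexity part of the deviation with the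
discretization error. -/
theorem resolution_add_deviation_le {E c ψ n L a b : ℝ} (hE : 0 ≤ E) (hc : 1 ≤ c) (hψ : 1 < ψ)
    (hn : 1 ≤ n) (hL : 0 < L) (hLa : 1 / L ≤ 2 * a) (ha : 0 ≤ a) (hb : 0 ≤ b) :
    2 * (E * ψ / L) + c * n * (1 + Real.log ψ) * (5 * a + 2 * b) ≤
      (5 * c + 4 * E) * (ψ * n * a + (1 + Real.log ψ) * n * b) := by
  have hψ0 : 0 < ψ := by linarith
  have hlog : 0 ≤ Real.log ψ := Real.log_nonneg hψ.le
  have hlog1 : 1 + Real.log ψ ≤ ψ := by linarith [Real.log_le_sub_one_of_pos hψ0]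
  have h1 : 2 * (E * ψ / L) ≤ 4 * E * (ψ * n * a) :=
    calc 2 * (E * ψ / L) = 2 * E * ψ * 1 * (1 / L) := by ring
      _ ≤ 2 * E * ψ * n * (2 * a) := by gcongr
      _ = _ := by ring
  have h2 : 5 * c * ((1 + Real.log ψ) * n * a) ≤ 5 * c * (ψ * n * a) := by gcongr
  have h3 : 2 * c * ((1 + Real.log ψ) * n * b) ≤ 5 * c * ((1 + Real.log ψ) * n * b) := by
    gcongr
    norm_num
  have h4 : 0 ≤ 4 * E * ((1 + Real.log ψ) * n * b) := by positivity
  linarith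

/-- Each agent owns an output bias, at resource `0`. -/
theorem le_numParams {N M R K : ℕ} (hM : 1 ≤ M) : N ≤ numParams N M R K := by
  have := Fintype.card_le_of_injective
    (fun i : Fin N => (Sum.inr (Sum.inr ((i, ⟨0, hM⟩), none)) : ParamIdx N M R K))
    fun a b h => by simpa using h
  simpa [numParams] using this

theorem abs_netInput_le {N M : ℕ} {y : Profile N M} {H : ℝ} (hv : ∀ i m, |y.1 i m| ≤ H)
    (hx : ∀ i m, |y.2.1 i m| ≤ H) (hb : ∀ m, |y.2.2 m| ≤ H) (j : InputIdx N M) :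
    |netInput y j| ≤ H := by
  rcases j with p | p | m
  exacts [hv _ _, hx _ _, hb _]

end RPFNet

/-! ### ### The generalization bound -/

set_option maxHeartbeats 1000000 in
theorem mainTheorem3 (vbar dbar bbar wbar : ℝ) :
    ∃ C : ℝ, 0 < C ∧
      ∀ (N M R K L : ℕ), 1 ≤ R → 1 ≤ K → 1 ≤ L →
      -- values, demands, budgets and agent weights
      ∀ (vlow dlow : ℝ), 0 < vlow → 0 < dlow →
      ∀ (V D : Set (RPFNet.Alloc N M)) (B : Set (Fin M → ℝ)),
        (∀ v ∈ V, ∀ i m, v i m ∈ Set.Icc vlow vbar) →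
        (∀ x ∈ D, ∀ i m, x i m ∈ Set.Icc dlow dbar) →
        (∀ b ∈ B, ∀ m, b m ∈ Set.Icc 0 bbar) →
      ∀ w : Fin N → ℝ, (∀ i, w i ∈ Set.Icc 0 wbar) →
      -- the distribution of the profiles
      ∀ (F : MeasureTheory.Measure (RPFNet.Profile N M)) [MeasureTheory.IsProbabilityMeasure F],
        (∀ᵐ y ∂F, y ∈ V ×ˢ D ×ˢ B) →
      -- the regularized proportional fairness activation and its constants
      ∀ (act : RPFNet.Profile N M → RPFNet.Alloc N M → RPFNet.Alloc N M) (Ω Φ ψ : ℝ),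
        1 < ψ → 1 ≤ Φ → 2 ≤ L * N * Ω * Φ * max (K : ℝ) (M * N) →
        RPFNet.IsRPFActivation w (V ×ˢ D ×ˢ B) act →
        RPFNet.LipschitzActivation R K (V ×ˢ D ×ˢ B) Ω Φ act →
        RPFNet.BoundedUtilities R K F Ω ψ act →
        -- the expectations are those of measurable functions
        (∀ ω ∈ RPFNet.paramBall N M R K Ω,
          AEMeasurable (RPFNet.logNSW w (RPFNet.rpfMechanism act ω)) F ∧
          ∀ i, AEMeasurable (RPFNet.expl V D (RPFNet.rpfMechanism act ω) i) F) →
      ∀ δ : ℝ, 0 < δ → δ < 1 →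
        MeasureTheory.Measure.pi (fun _ : Fin L => F)
          {s | ¬ ∀ ω ∈ RPFNet.paramBall N M R K Ω, ∀ i : Fin N,
            max (RPFNet.genErrLogNSW w F (RPFNet.rpfMechanism act ω) s)
                (RPFNet.genErrExpl V D F (RPFNet.rpfMechanism act ω) i s) ≤
              C * (ψ * N * Real.sqrt (R * RPFNet.numParams N M R K *
                      Real.log (L * N * Ω * Φ * max (K : ℝ) (M * N)) / L) +
                (1 + Real.log ψ) * N * Real.sqrt (Real.log (1 / δ) / L))}
          ≤ ENNReal.ofReal δ := by
  -- `c₀` governs the range of the objectives, `H` the network inputs, `E` the net error. Absolute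
  -- values are needed because `C` is chosen before any sign is known.
  set c₀ : ℝ := 1 + |wbar| + |dbar| with hc₀
  set H : ℝ := 1 + |vbar| + |dbar| + |bbar| with hH
  set E : ℝ := (|wbar| + 2) * |vbar| * H with hE
  have hc₀1 : 1 ≤ c₀ := by linarith [abs_nonneg wbar, abs_nonneg dbar]
  have hH1 : 1 ≤ H := by linarith [abs_nonneg vbar, abs_nonneg dbar, abs_nonneg bbar]
  have hE0 : 0 ≤ E := by positivity
  refine ⟨5 * c₀ + 4 * E, by positivity, ?_⟩
  intro N M R K L hR hK hL vlow dlow hvlow hdlow V D B hV hD hB w hw F _ hF act Ω Φ ψ hψ hΦ hA2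
    hact hlip hutil hmeas δ hδ hδ1
  set mx : ℝ := max (K : ℝ) (M * N) with hmx
  set A : ℝ := L * N * Ω * Φ * mx with hA
  set d : ℕ := RPFNet.numParams N M R K with hd
  have hL1 : (1 : ℝ) ≤ L := by exact_mod_cast hL
  have hmx1 : 1 ≤ mx := le_max_of_le_left (by exact_mod_cast hK)
  -- The assumption `2 ≤ A` rules out `N = 0`, and below also `Ω ≤ 0`.
  have hN : 1 ≤ N := by
    by_contra hN
    have : N = 0 := by omega
    subst this
    norm_num [hA] at hA2
  have hN1 : (1 : ℝ) ≤ N := by exact_mod_cast hN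
  have hΩ : 0 < Ω := by
    by_contra! hΩ
    have : A = Ω * (L * N * Φ * mx) := by rw [hA]; ring
    have h2 : A ≤ 0 := this ▸ mul_nonpos_of_nonpos_of_nonneg hΩ (by positivity)
    linarith
  have hΩA : Ω ≤ A := by
    have h : 1 ≤ L * N * Φ * mx := by
      refine one_le_mul_of_one_le_of_one_le (one_le_mul_of_one_le_of_one_le
        (one_le_mul_of_one_le_of_one_le hL1 hN1) hΦ) hmx1
    calc Ω ≤ Ω * (L * N * Φ * mx) := le_mul_of_one_le_right hΩ.le h
      _ = A := by rw [hA]; ring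
  have hLA : L * Ω * Φ ≤ A :=
    calc L * Ω * Φ ≤ L * Ω * Φ * (N * mx) := le_mul_of_one_le_right (by positivity)
          (one_le_mul_of_one_le_of_one_le hN1 hmx1)
      _ = A := by rw [hA]; ring
  have hψ0 : 0 < ψ := by linarith
  have hlogψ : 0 ≤ Real.log ψ := Real.log_nonneg hψ.le
  have hA0 : 0 < A := by linarith
  -- profiles at which all pointwise assumptions hold
  obtain ⟨G, hGdef⟩ : ∃ G : Set (RPFNet.Profile N M), G = {y | y ∈ V ×ˢ D ×ˢ B ∧ ∀ i,
    (∀ ω ∈ RPFNet.paramBall N M R K Ω,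
      1 / ψ ≤ RPFNet.utility (RPFNet.rpfMechanism act ω y) y.1 y.2.1 i ∧
        RPFNet.utility (RPFNet.rpfMechanism act ω y) y.1 y.2.1 i ≤ ψ) ∧
    ∀ S : Finset (Fin M), ∑ m ∈ S, y.1 i m ≤ 1} := ⟨_, rfl⟩
  have hG : ∀ᵐ y ∂F, y ∈ G := by
    rw [hGdef]
    filter_upwards [hF, hutil] with y h1 h2 using ⟨h1, h2⟩
  have hGY : ∀ y ∈ G, y ∈ V ×ˢ D ×ˢ B := fun y hy => by rw [hGdef] at hy; exact hy.1
  have hGu : ∀ y ∈ G, ∀ ω ∈ RPFNet.paramBall N M R K Ω, ∀ i,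
      1 / ψ ≤ RPFNet.utility (RPFNet.rpfMechanism act ω y) y.1 y.2.1 i ∧
        RPFNet.utility (RPFNet.rpfMechanism act ω y) y.1 y.2.1 i ≤ ψ :=
    fun y hy ω hω i => by rw [hGdef] at hy; exact (hy.2 i).1 ω hω
  have hGs : ∀ y ∈ G, ∀ i, ∑ m, y.1 i m ≤ 1 :=
    fun y hy i => by rw [hGdef] at hy; exact (hy.2 i).2 Finset.univ
  -- Without resources all utilities vanish, against the lower bound `1 / ψ` at `ω = 0`.
  have hM : 1 ≤ M := by
    by_contra hM
    have hM0 : M = 0 := by omega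
    subst hM0
    obtain ⟨y, hy⟩ := hG.exists
    have h := (hGu y hy (fun _ => 0) (by simp [RPFNet.paramBall, hΩ.le]) ⟨0, hN⟩).1
    have h0 : 0 < 1 / ψ := by positivity
    simp only [RPFNet.utility, Finset.univ_eq_empty, Finset.sum_empty] at h
    linarith
  have hNd : N ≤ d := RPFNet.le_numParams hM
  have hw0 : 0 ≤ wbar := (hw ⟨0, hN⟩).1.trans (hw ⟨0, hN⟩).2
  have hYv : ∀ y ∈ V ×ˢ D ×ˢ B, ∀ i m, 0 ≤ y.1 i m ∧ |y.1 i m| ≤ |vbar| := fun y hy i m => by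
    have h := hV _ hy.1 i m
    have h0 := hvlow.le.trans h.1
    exact ⟨h0, abs_le_abs_of_nonneg h0 h.2⟩
  have hYx : ∀ y ∈ V ×ˢ D ×ˢ B, ∀ i m, y.2.1 i m ∈ Set.Icc 0 |dbar| := fun y hy i m => by
    have h := hD _ hy.2.1 i m
    exact ⟨hdlow.le.trans h.1, h.2.trans (le_abs_self _)⟩
  have hYb : ∀ y ∈ V ×ˢ D ×ˢ B, ∀ m, y.2.2 m ∈ Set.Icc 0 |bbar| := fun y hy m => by
    have h := hB _ hy.2.2 m
    exact ⟨h.1, h.2.trans (le_abs_self _)⟩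
  have hfeas : ∀ ω : RPFNet.ParamIdx N M R K → ℝ, ∀ y ∈ V ×ˢ D ×ˢ B,
      RPFNet.rpfMechanism act ω y ∈ RPFNet.feasibleSet y := fun ω y hy => (hact y hy _).1
  -- Lipschitz dependence of the mechanism on the parameters
  have hmech : ∀ y ∈ V ×ˢ D ×ˢ B, ∀ ω ∈ RPFNet.paramBall N M R K Ω,
      ∀ ω' ∈ RPFNet.paramBall N M R K Ω, ∑ p, |ω p - ω' p| ≤ Ω / A ^ (7 * R) →
      ∑ i, ∑ m, |RPFNet.rpfMechanism act ω y i m - RPFNet.rpfMechanism act ω' y i m| ≤ H / L := by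
    intro y hy ω hω ω' hω' hΔ
    have hin := RPFNet.abs_netInput_le (y := y) (H := H)
      (fun i m => by linarith [(hYv y hy i m).2, abs_nonneg dbar, abs_nonneg bbar])
      (fun i m => by
        rw [abs_of_nonneg (hYx y hy i m).1]
        linarith [(hYx y hy i m).2, abs_nonneg vbar, abs_nonneg bbar])
      (fun m => by
        rw [abs_of_nonneg (hYb y hy m).1]
        linarith [(hYb y hy m).2, abs_nonneg vbar, abs_nonneg dbar])
    calc _ ≤ Φ * ∑ i, ∑ m, |RPFNet.network ω y i m - RPFNet.network ω' y i m| :=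
          hlip y hy ω hω ω' hω'
      _ ≤ Φ * (H * (2 + Ω) ^ (R + 1) * (Ω / A ^ (7 * R))) := by
          refine mul_le_mul_of_nonneg_left ((RPFNet.sum_abs_network_sub_le hR hH1 hin hω hω').trans
            ?_) (by linarith)
          gcongr
      _ = H * (Φ * ((2 + Ω) ^ (R + 1) * (Ω / A ^ (7 * R)))) := by ring
      _ ≤ H * (1 / L) := by
          gcongr
          exact RPFNet.lipschitz_mul_resolution_le hR hA2 (by positivity) hΩ hΩA (by linarith) hLA
      _ = H / L := mul_one_div _ _
  obtain ⟨net, hnet1, hnet2, hnet3⟩ := RPFNet.exists_l1_net (ι := RPFNet.ParamIdx N M R K) hΩ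
    (show 0 < Ω / A ^ (7 * R) by positivity)
  rw [div_div_cancel₀ hΩ.ne'] at hnet3
  -- the two kinds of objectives as one family
  let g : Option (Fin N) → (RPFNet.ParamIdx N M R K → ℝ) → RPFNet.Profile N M → ℝ := fun j ω y =>
    j.elim (-RPFNet.logNSW w (RPFNet.rpfMechanism act ω) y)
      fun i => RPFNet.expl V D (RPFNet.rpfMechanism act ω) i y
  set c : ℝ := c₀ * N * (1 + Real.log ψ) with hc
  have hc0 : 0 < c := by positivity
  have hgm : ∀ j, ∀ ω ∈ RPFNet.paramBall N M R K Ω, AEMeasurable (g j ω) F := by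
    rintro (_ | i) ω hω
    exacts [(hmeas ω hω).1.neg, (hmeas ω hω).2 i]
  have hgb : ∀ j, ∀ ω ∈ RPFNet.paramBall N M R K Ω, ∀ y ∈ G, |g j ω y| ≤ c := by
    rintro (_ | i) ω hω y hy
    · show |-RPFNet.logNSW w (RPFNet.rpfMechanism act ω) y| ≤ c
      rw [abs_neg]
      refine (RPFNet.abs_logNSW_le hψ hw (hGu y hy ω hω)).trans ?_
      calc N * (wbar * Real.log ψ) = wbar * N * Real.log ψ := by ring
        _ ≤ c₀ * N * (1 + Real.log ψ) := by
          gcongr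
          · linarith [le_abs_self wbar, abs_nonneg dbar]
          · linarith
    · refine (RPFNet.abs_expl_le (hGY y hy) (hfeas ω) (abs_nonneg dbar)
        (fun m => (hYv y (hGY y hy) i m).1) (hGs y hy i) (hYx y (hGY y hy) i)).trans ?_
      calc |dbar| ≤ c₀ := by linarith [abs_nonneg wbar]
        _ = c₀ * 1 * 1 := by ring
        _ ≤ c₀ * N * (1 + Real.log ψ) := by
          gcongr
          linarith
  have hgη : ∀ ω ∈ RPFNet.paramBall N M R K Ω, ∃ ω' ∈ net, ∀ j, ∀ y ∈ G,
      |g j ω y - g j ω' y| ≤ E * ψ / L := by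
    intro ω hω
    obtain ⟨ω', hω', hΔ⟩ := hnet2 ω hω
    -- The net must lie inside the ball, since the assumptions say nothing about parameters outside
    -- it.
    have hω'S : ω' ∈ RPFNet.paramBall N M R K Ω := hnet1 ω' hω'
    refine ⟨ω', hω', ?_⟩
    rintro (_ | i) y hy
    · show |-RPFNet.logNSW w _ y - -RPFNet.logNSW w _ y| ≤ _
      rw [neg_sub_neg, abs_sub_comm]
      refine (RPFNet.abs_logNSW_sub_le hψ hw0 hw (fun i m => (hYv y (hGY y hy) i m).2)
        (fun i => (hGu y hy ω hω i).1) (fun i => (hGu y hy ω' hω'S i).1)).trans ?_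
      calc _ ≤ (|wbar| + 2) * ψ * |vbar| * (H / L) := by
            gcongr
            · linarith [le_abs_self wbar]
            · exact hmech y (hGY y hy) ω hω ω' hω'S hΔ
        _ = E * ψ / L := by rw [hE]; ring
    · have hbdd : ∀ ω, BddAbove
          (RPFNet.misreportUtilities V D (RPFNet.rpfMechanism act ω) i y) := fun ω =>
        bddAbove_Icc.mono (RPFNet.misreportUtilities_subset_Icc (hGY y hy) (hfeas ω)
          (abs_nonneg dbar) (fun m => (hYv y (hGY y hy) i m).1) (hGs y hy i)
          (hYx y (hGY y hy) i))
      refine (RPFNet.abs_expl_sub_le (e := |vbar| * (H / L)) (hGY y hy) (hbdd ω) (hbdd ω')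
        fun y' hy' => ?_).trans ?_
      -- `y'` may lie outside `G`; the Lipschitz bound for the mechanism still applies there.
      · refine (RPFNet.abs_utility_sub_le i fun m => (hYv y (hGY y hy) i m).2).trans ?_
        gcongr
        refine le_trans ?_ (hmech y' hy' ω hω ω' hω'S hΔ)
        exact Finset.single_le_sum (f := fun i => ∑ m, |RPFNet.rpfMechanism act ω y' i m -
          RPFNet.rpfMechanism act ω' y' i m|)
          (fun i _ => Finset.sum_nonneg fun m _ => abs_nonneg _) (Finset.mem_univ i)
      · calc 2 * (|vbar| * (H / L)) = 2 * 1 * (|vbar| * (H / L)) := by ring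
          _ ≤ (|wbar| + 2) * ψ * (|vbar| * (H / L)) := by
            gcongr
            linarith [abs_nonneg wbar]
          _ = E * ψ / L := by rw [hE]; ring
  set a := Real.sqrt (R * d * Real.log A / L) with ha
  set b := Real.sqrt (Real.log (1 / δ) / L) with hb
  have hdev := RPFNet.measure_uniform_deviation_le F hL net hnet1 hG hgm hc0 hgb hgη
    (t := c * (5 * a + 2 * b)) (by positivity)
  have hlogA : 1 / 2 ≤ Real.log A := by
    have := Real.log_le_log two_pos hA2
    linarith [Real.log_two_gt_d9]
  have hX : 1 / 2 ≤ R * d * Real.log A := by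
    have h1 : (1 : ℝ) ≤ R * d := by exact_mod_cast Nat.mul_pos hR (hN.trans hNd)
    nlinarith
  refine (measure_mono ?_).trans (hdev.trans (ENNReal.ofReal_le_ofReal ?_))
  · intro s hs hall
    refine hs fun ω hω i => ?_
    have hLa : 1 / (L : ℝ) ≤ 2 * a := RPFNet.one_div_le_two_mul_sqrt hX hL
    have hbound := RPFNet.resolution_add_deviation_le hE0 hc₀1 hψ hN1 (by positivity) hLa
      (Real.sqrt_nonneg (R * d * Real.log A / L)) (Real.sqrt_nonneg (Real.log (1 / δ) / L))
    refine max_le ?_ ((hall ω hω (some i)).trans hbound)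
    refine le_trans (le_of_eq ?_) ((hall ω hω none).trans hbound)
    -- The sign in `g none` makes the welfare error an expectation minus an empirical mean.
    show -(∫ y, RPFNet.logNSW w _ y ∂F) + _ =
      (∫ y, -RPFNet.logNSW w (RPFNet.rpfMechanism act ω) y ∂F) -
        (1 / (L : ℝ)) * ∑ l, -RPFNet.logNSW w (RPFNet.rpfMechanism act ω) (s l)
    rw [integral_neg, Finset.sum_neg_distrib]
    ring
  · rw [Fintype.card_option, Fintype.card_fin]
    refine le_trans ?_ (RPFNet.exp_mul_exp_deviation_le (X := R * d * Real.log A) (L := L)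
      (by linarith) (by positivity) hδ hδ1 hc0)
    gcongr
    exact RPFNet.card_mul_net_le hR hA2 hNd hnet3
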